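/- Let $\Omega\subset\mathbb R^d$, $d\ge 1$, be a bounded open set, let $H^1_0(\Omega)$ be the closure of $C_c^\infty(\Omega)$ in $H^1(\Omega)$, and let $H^{-1}(\Omega)$ be the space of bounded linear functionals on $H^1_0(\Omega)$. Let $(\lambda_k,\phi_k)_{k\ge1}$ be a spectral decomposition of the Dirichlet Laplacian on $\Omega$: $\phi_k\in H^1_0(\Omega)$, $\int_\Omega\nabla\phi_k\cdot\nabla v\,dx=\lambda_k\int_\Omega\phi_k v\,dx$ for all $v\in H^1_0(\Omega)$, $(\lambda_k)$ is non-decreasing, and $(\phi_k)$ is an orthonormal basis of $L^2(\Omega)$. Let $\tau>0$, let $(w_k)_{k\ge1}$ be any sequence of independent real random variables with mean zero and variance one on any probability space $(\Xi,\mathfrak F,\mu)$, and put $$\Phi^{(n)}(\xi)=\tau\sum_{k=1}^n(1+\lambda_k)^{-1/2}\,w_k(\xi)\,\phi_k\in H^1_0(\Omega).$$ Let $L$ be a second-order linear elliptic operator with $Lu\in H^{-1}(\Omega)$ for every $u\in H^1_0(\Omega)$ (more generally, any linear map $L:H^1_0(\Omega)\to H^{-1}(\Omega)$), let $f\in H^{-1}(\Omega)$,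 and for $u\in H^1_0(\Omega)$ let $R_u=Lu-f\in H^{-1}(\Omega)$. Then: 1. For every $u\in H^1_0(\Omega)$ the norm $$\|R_u\|_\Phi:=\Bigl(\lim_{n\to\infty}\int_\Xi|R_u(\Phi^{(n)}(\xi))|^2\,d\mu(\xi)\Bigr)^{1/2}$$ is well defined: the integrals are finite and the limit exists and is finite. 2. A function $u\in H^1_0(\Omega)$ is a weak solution of the homogeneous Dirichlet problem $Lu=f$ in $\Omega$, $u=0$ on $\partial\Omega$ (that is, $R_u(\varphi)=0$ for all $\varphi\in H^1_0(\Omega)$) if and only if it is a $\Phi$-stochastically weak solution (that is, $\|R_u\|_\Phi=0$). 3. Hence $\Phi$-stochastically weak solutions are unique exactly when weak solutions are: there is at most one solution of the one kind if and only if there is at most one of the other kind, and there is exactly one of the one kind if and only if there is exactly one of the other kind. -/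

import Mathlib

open MeasureTheory ProbabilityTheory Filter Topology TopologicalSpace
open scoped Distributions InnerProductSpace

namespace StochWeak

/-- The space `L²(Ω)` of real functions, with Lebesgue measure restricted to `Ω`. -/
abbrev L2 {d : ℕ} (Ω : Opens (EuclideanSpace ℝ (Fin d))) : Type :=
  Lp ℝ 2 ((volume : Measure (EuclideanSpace ℝ (Fin d))).restrict (Ω : Set _))

/-- The space `L²(Ω; ℝᵈ)` of vector fields, with the Euclidean norm on `ℝᵈ`. -/
abbrev L2Vec {d : ℕ} (Ω : Opens (EuclideanSpace ℝ (Fin d))) : Type :=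
  Lp (EuclideanSpace ℝ (Fin d)) 2
    ((volume : Measure (EuclideanSpace ℝ (Fin d))).restrict (Ω : Set _))

/-- `g` is the weak gradient of `u` in `Ω`: for every test function `ψ ∈ C_c^∞(Ω)` and every
coordinate `i`, `∫_Ω u ∂ᵢψ = - ∫_Ω gᵢ ψ`. -/
def HasWeakGradient {d : ℕ} (Ω : Opens (EuclideanSpace ℝ (Fin d))) (u : L2 Ω) (g : L2Vec Ω) :
    Prop :=
  ∀ (ψ : 𝓓(Ω, ℝ)) (i : Fin d),
    ∫ x in (Ω : Set _), u x * fderiv ℝ ψ x (EuclideanSpace.single i 1)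
      = - ∫ x in (Ω : Set _), g x i * ψ x

theorem memLp_test {d : ℕ} {Ω : Opens (EuclideanSpace ℝ (Fin d))} (ψ : 𝓓(Ω, ℝ)) :
    MemLp ψ 2 ((volume : Measure (EuclideanSpace ℝ (Fin d))).restrict (Ω : Set _)) :=
  ψ.continuous.memLp_of_hasCompactSupport ψ.hasCompactSupport

theorem memLp_test_deriv {d : ℕ} {Ω : Opens (EuclideanSpace ℝ (Fin d))} (ψ : 𝓓(Ω, ℝ))
    (e : EuclideanSpace ℝ (Fin d)) :
    MemLp (fun x => fderiv ℝ ψ x e) 2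
      ((volume : Measure (EuclideanSpace ℝ (Fin d))).restrict (Ω : Set _)) :=
  ((ψ.contDiff.continuous_fderiv (by simp)).clm_apply
    continuous_const).memLp_of_hasCompactSupport (ψ.hasCompactSupport.fderiv_apply ℝ e)

theorem memLp_coord {d : ℕ} {Ω : Opens (EuclideanSpace ℝ (Fin d))} (g : L2Vec Ω) (i : Fin d) :
    MemLp (fun x => g x i) 2
      ((volume : Measure (EuclideanSpace ℝ (Fin d))).restrict (Ω : Set _)) :=
  (EuclideanSpace.proj (𝕜 := ℝ) i).comp_memLp' (Lp.memLp g)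

theorem HasWeakGradient.add {d : ℕ} {Ω : Opens (EuclideanSpace ℝ (Fin d))}
    {u v : L2 Ω} {g h : L2Vec Ω} (hu : HasWeakGradient Ω u g) (hv : HasWeakGradient Ω v h) :
    HasWeakGradient Ω (u + v) (g + h) := by
  intro ψ i
  have e1 : ∫ x in (Ω : Set _), (u + v) x * fderiv ℝ ψ x (EuclideanSpace.single i 1)
      = (∫ x in (Ω : Set _), u x * fderiv ℝ ψ x (EuclideanSpace.single i 1))
        + ∫ x in (Ω : Set _), v x * fderiv ℝ ψ x (EuclideanSpace.single i 1) := by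
    refine Eq.trans (integral_congr_ae ?_)
      (integral_add ((Lp.memLp u).integrable_mul (memLp_test_deriv ψ _))
        ((Lp.memLp v).integrable_mul (memLp_test_deriv ψ _)))
    filter_upwards [Lp.coeFn_add u v] with x hx
    rw [hx, Pi.add_apply, add_mul]
  have e2 : ∫ x in (Ω : Set _), (g + h) x i * ψ x
      = (∫ x in (Ω : Set _), g x i * ψ x) + ∫ x in (Ω : Set _), h x i * ψ x := by
    refine Eq.trans (integral_congr_ae ?_)
      (integral_add ((memLp_coord g i).integrable_mul (memLp_test ψ))
        ((memLp_coord h i).integrable_mul (memLp_test ψ)))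
    filter_upwards [Lp.coeFn_add g h] with x hx
    rw [hx, Pi.add_apply, PiLp.add_apply, add_mul]
  rw [e1, e2, hu ψ i, hv ψ i, neg_add]

theorem HasWeakGradient.smul {d : ℕ} {Ω : Opens (EuclideanSpace ℝ (Fin d))}
    {u : L2 Ω} {g : L2Vec Ω} (c : ℝ) (hu : HasWeakGradient Ω u g) :
    HasWeakGradient Ω (c • u) (c • g) := by
  intro ψ i
  have e1 : ∫ x in (Ω : Set _), (c • u) x * fderiv ℝ ψ x (EuclideanSpace.single i 1)
      = c * ∫ x in (Ω : Set _), u x * fderiv ℝ ψ x (EuclideanSpace.single i 1) := by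
    rw [← integral_const_mul]
    refine integral_congr_ae ?_
    filter_upwards [Lp.coeFn_smul c u] with x hx
    rw [hx, Pi.smul_apply, smul_eq_mul, mul_assoc]
  have e2 : ∫ x in (Ω : Set _), (c • g) x i * ψ x = c * ∫ x in (Ω : Set _), g x i * ψ x := by
    rw [← integral_const_mul]
    refine integral_congr_ae ?_
    filter_upwards [Lp.coeFn_smul c g] with x hx
    rw [hx, Pi.smul_apply, PiLp.smul_apply, smul_eq_mul, mul_assoc]
  rw [e1, e2, hu ψ i, mul_neg]

/-- The Sobolev space `H¹(Ω)`: functions `u ∈ L²(Ω)` with a weak gradient `∇u ∈ L²(Ω; ℝᵈ)`.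
An element is stored as the pair `(u, ∇u)`, and the norm is
`‖u‖² = ‖u‖²_{L²} + ‖∇u‖²_{L²}`. -/
noncomputable def H1 {d : ℕ} (Ω : Opens (EuclideanSpace ℝ (Fin d))) :
    Submodule ℝ (WithLp 2 (L2 Ω × L2Vec Ω)) where
  carrier := {p | HasWeakGradient Ω p.fst p.snd}
  add_mem' := fun ha hb => HasWeakGradient.add ha hb
  zero_mem' := by
    have h0 : HasWeakGradient Ω (0 : L2 Ω) (0 : L2Vec Ω) := by
      intro ψ i
      have e1 : ∫ x in (Ω : Set _), (0 : L2 Ω) x * fderiv ℝ ψ x (EuclideanSpace.single i 1)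
          = 0 := by
        refine integral_eq_zero_of_ae ?_
        filter_upwards [Lp.coeFn_zero ℝ 2
          ((volume : Measure (EuclideanSpace ℝ (Fin d))).restrict (Ω : Set _))] with x hx
        rw [hx]
        simp
      have e2 : ∫ x in (Ω : Set _), (0 : L2Vec Ω) x i * ψ x = 0 := by
        refine integral_eq_zero_of_ae ?_
        filter_upwards [Lp.coeFn_zero (EuclideanSpace ℝ (Fin d)) 2
          ((volume : Measure (EuclideanSpace ℝ (Fin d))).restrict (Ω : Set _))] with x hx
        rw [hx]
        simp
      rw [e1, e2, neg_zero]
    exact h0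
  smul_mem' := fun c _ hx => HasWeakGradient.smul c hx

/-- The space `H¹₀(Ω)`: the closure of `C_c^∞(Ω)` in `H¹(Ω)`. (The test functions form a linear
subspace, so that taking the span adds nothing.) -/
noncomputable def H01 {d : ℕ} (Ω : Opens (EuclideanSpace ℝ (Fin d))) : Submodule ℝ (H1 Ω) :=
  (Submodule.span ℝ {v : H1 Ω | ∃ ψ : 𝓓(Ω, ℝ),
    (v : WithLp 2 (L2 Ω × L2Vec Ω)).fst
      =ᵐ[(volume : Measure (EuclideanSpace ℝ (Fin d))).restrict (Ω : Set _)] ψ}).topologicalClosure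

/-- The function `u ∈ L²(Ω)` underlying an element of `H¹₀(Ω)`. -/
noncomputable def H01.fn {d : ℕ} {Ω : Opens (EuclideanSpace ℝ (Fin d))} (u : H01 Ω) : L2 Ω :=
  ((u : H1 Ω) : WithLp 2 (L2 Ω × L2Vec Ω)).fst

/-- The weak gradient `∇u ∈ L²(Ω; ℝᵈ)` of an element of `H¹₀(Ω)`. -/
noncomputable def H01.grad {d : ℕ} {Ω : Opens (EuclideanSpace ℝ (Fin d))} (u : H01 Ω) : L2Vec Ω :=
  ((u : H1 Ω) : WithLp 2 (L2 Ω × L2Vec Ω)).snd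

/-- `H⁻¹(Ω)`: the bounded linear functionals on `H¹₀(Ω)`. -/
abbrev Hneg1 {d : ℕ} (Ω : Opens (EuclideanSpace ℝ (Fin d))) : Type :=
  H01 Ω →L[ℝ] ℝ

/-- A spectral decomposition of the Dirichlet Laplacian: `φ k ∈ H¹₀(Ω)` solves
`-Δ φ k = lam k • φ k` weakly with zero boundary values, the eigenvalues are listed in
non-decreasing order, and `φ` is an orthonormal basis of `L²(Ω)`. -/
structure IsDirichletSpectralDecomposition {d : ℕ} (Ω : Opens (EuclideanSpace ℝ (Fin d)))
    (lam : ℕ → ℝ) (φ : ℕ → H01 Ω) : Prop where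
  eigen : ∀ (k : ℕ) (v : H01 Ω),
    inner ℝ (H01.grad (φ k)) (H01.grad v) = lam k * inner ℝ (H01.fn (φ k)) (H01.fn v)
  monotone : Monotone lam
  orthonormal : Orthonormal ℝ (fun k => H01.fn (φ k))
  total : (Submodule.span ℝ (Set.range fun k => H01.fn (φ k))).topologicalClosure = ⊤

/-- The partial sum `Φ⁽ⁿ⁾(ξ) = τ ∑_{k < n} (1 + lam k)^{-1/2} w_k(ξ) φ_k` of the random test
function (indices start at `0`). -/
noncomputable def randomTest {d : ℕ} {Ω : Opens (EuclideanSpace ℝ (Fin d))} {Ξ : Type*}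
    (τ : ℝ) (lam : ℕ → ℝ) (φ : ℕ → H01 Ω) (w : ℕ → Ξ → ℝ) (n : ℕ) (ξ : Ξ) : H01 Ω :=
  τ • ∑ k ∈ Finset.range n, ((1 + lam k) ^ (-(1 / 2) : ℝ) * w k ξ) • φ k

/-- The squared `Φ`-norm `‖R‖_Φ² = lim_{n → ∞} 𝔼[|R(Φ⁽ⁿ⁾)|²]` of a functional `R`. -/
noncomputable def phiNormSq {d : ℕ} {Ω : Opens (EuclideanSpace ℝ (Fin d))} {Ξ : Type*}
    [MeasurableSpace Ξ] (μ : Measure Ξ) (τ : ℝ) (lam : ℕ → ℝ) (φ : ℕ → H01 Ω) (w : ℕ → Ξ → ℝ)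
    (R : Hneg1 Ω) : ℝ :=
  limUnder atTop fun n : ℕ => ∫ ξ, |R (randomTest τ lam φ w n ξ)| ^ 2 ∂μ

/-- The `Φ`-norm `‖R‖_Φ`. -/
noncomputable def phiNorm {d : ℕ} {Ω : Opens (EuclideanSpace ℝ (Fin d))} {Ξ : Type*}
    [MeasurableSpace Ξ] (μ : Measure Ξ) (τ : ℝ) (lam : ℕ → ℝ) (φ : ℕ → H01 Ω) (w : ℕ → Ξ → ℝ)
    (R : Hneg1 Ω) : ℝ :=
  √(phiNormSq μ τ lam φ w R)

/-- The weak residual `R_u = Lu - f ∈ H⁻¹(Ω)`. -/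
noncomputable def residual {d : ℕ} {Ω : Opens (EuclideanSpace ℝ (Fin d))} (L : H01 Ω →ₗ[ℝ] Hneg1 Ω)
    (f : Hneg1 Ω) (u : H01 Ω) : Hneg1 Ω :=
  L u - f

/-- `u ∈ H¹₀(Ω)` is a weak solution of `Lu = f` in `Ω`, `u = 0` on `∂Ω`. -/
def IsWeakSolution {d : ℕ} {Ω : Opens (EuclideanSpace ℝ (Fin d))} (L : H01 Ω →ₗ[ℝ] Hneg1 Ω)
    (f : Hneg1 Ω) (u : H01 Ω) : Prop :=
  ∀ v : H01 Ω, residual L f u v = 0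

/-- `u ∈ H¹₀(Ω)` is a `Φ`-stochastically weak solution of `Lu = f` in `Ω`, `u = 0` on `∂Ω`. -/
def IsStochasticallyWeakSolution {d : ℕ} {Ω : Opens (EuclideanSpace ℝ (Fin d))} {Ξ : Type*}
    [MeasurableSpace Ξ] (μ : Measure Ξ) (τ : ℝ) (lam : ℕ → ℝ) (φ : ℕ → H01 Ω) (w : ℕ → Ξ → ℝ)
    (L : H01 Ω →ₗ[ℝ] Hneg1 Ω) (f : Hneg1 Ω) (u : H01 Ω) : Prop :=
  phiNorm μ τ lam φ w (residual L f u) = 0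

end StochWeak

/-!
The functional `R ∈ H⁻¹(Ω)` is recovered from its random evaluations because the rescaled
eigenfunctions `e k = (1 + lam k) ^ (-1/2) • φ k` form a Hilbert basis of `H¹₀(Ω)`, for which
`Φ⁽ⁿ⁾ = τ ∑_{k < n} w k • e k` is white noise truncated after `n` terms.

Orthonormality of `e` is the eigenvalue equation: `⟪φ k, v⟫_{H¹} = (1 + lam k) ⟪φ k, v⟫_{L²}`.
Completeness (`eq_zero_of_inner_eigenfunction_eq_zero`) follows from the same identity: a vector
`v ∈ H¹₀(Ω)` orthogonal to all the `φ k` in `H¹` is orthogonal to all of them in `L²`, hence its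
function part vanishes, and then so does its weak gradient. As the `w k` have mean zero, variance
one and are pairwise independent, `𝔼 |R(Φ⁽ⁿ⁾)|² = τ² ∑_{k < n} R(e k)²`
(`integral_sq_randomTest`). By the Riesz representation theorem, which requires `H¹₀(Ω)` to be
complete, and by Parseval's identity these expectations tend to `τ² ‖R‖²`. Thus
`‖R‖_Φ = τ ‖R‖_{H⁻¹}` (`phiNorm_eq`): the `Φ`-norm is a positive multiple of the dual norm, so it
vanishes exactly at `R = 0`, and the two notions of solution are the same.
-/

namespace StochWeak

/-! ### Completeness of `H¹₀(Ω)` -/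

section Sobolev

variable {d : ℕ} {Ω : Opens (EuclideanSpace ℝ (Fin d))}

theorem continuous_integral_mul {h : EuclideanSpace ℝ (Fin d) → ℝ}
    (hh : MemLp h 2 ((volume : Measure (EuclideanSpace ℝ (Fin d))).restrict (Ω : Set _))) :
    Continuous fun u : L2 Ω => ∫ x in (Ω : Set _), u x * h x := by
  have key : (fun u : L2 Ω => ∫ x in (Ω : Set _), u x * h x)
      = fun u => inner ℝ (hh.toLp h) u := by
    funext u
    rw [L2.inner_def]
    refine integral_congr_ae ?_
    filter_upwards [hh.coeFn_toLp] with x hx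
    rw [hx]
    simp
  rw [key]
  fun_prop

theorem continuous_integral_coord_mul (i : Fin d) {h : EuclideanSpace ℝ (Fin d) → ℝ}
    (hh : MemLp h 2 ((volume : Measure (EuclideanSpace ℝ (Fin d))).restrict (Ω : Set _))) :
    Continuous fun g : L2Vec Ω => ∫ x in (Ω : Set _), g x i * h x := by
  let P : L2Vec Ω →L[ℝ] L2 Ω :=
    (EuclideanSpace.proj (𝕜 := ℝ) i).compLpL 2 _
  have key : (fun g : L2Vec Ω => ∫ x in (Ω : Set _), g x i * h x)
      = fun g => ∫ x in (Ω : Set _), P g x * h x := by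
    funext g
    refine integral_congr_ae ?_
    filter_upwards [(EuclideanSpace.proj (𝕜 := ℝ) i).coeFn_compLpL g] with x hx
    rw [hx]
    rfl
  rw [key]
  exact (continuous_integral_mul hh).comp P.continuous

/-- The weak gradient is a closed operator. -/
theorem isClosed_H1 : IsClosed (H1 Ω : Set (WithLp 2 (L2 Ω × L2Vec Ω))) := by
  have h : (H1 Ω : Set (WithLp 2 (L2 Ω × L2Vec Ω)))
      = ⋂ (ψ : 𝓓(Ω, ℝ)) (i : Fin d), {p | ∫ x in (Ω : Set _),
          p.fst x * fderiv ℝ ψ x (EuclideanSpace.single i 1)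
            = - ∫ x in (Ω : Set _), p.snd x i * ψ x} := by
    ext p
    simp only [Set.mem_iInter]
    rfl
  rw [h]
  refine isClosed_iInter fun ψ => isClosed_iInter fun i => isClosed_eq ?_ ?_
  · exact (continuous_integral_mul (memLp_test_deriv ψ _)).comp
      (WithLp.prod_continuous_ofLp 2 _ _).fst
  · exact ((continuous_integral_coord_mul i (memLp_test ψ)).comp
      (WithLp.prod_continuous_ofLp 2 _ _).snd).neg

instance completeSpace_H1 : CompleteSpace (H1 Ω) :=
  isClosed_H1.completeSpace_coe

instance completeSpace_H01 : CompleteSpace (H01 Ω) :=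
  (Submodule.isClosed_topologicalClosure _).completeSpace_coe

/-- The structure inherited from `H¹(Ω)`, named so that instance search finds it at once. -/
noncomputable instance normedAddCommGroup_H01 : NormedAddCommGroup (H01 Ω) :=
  Submodule.normedAddCommGroup _

/-- The inner product `⟪u, v⟫_{L²} + ⟪∇u, ∇v⟫_{L²}` inherited from `H¹(Ω)`. -/
noncomputable instance innerProductSpace_H01 : InnerProductSpace ℝ (H01 Ω) :=
  Submodule.innerProductSpace _

theorem H01.inner_eq (u v : H01 Ω) :
    inner ℝ u v = inner ℝ (H01.fn u) (H01.fn v) + inner ℝ (H01.grad u) (H01.grad v) := rfl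

/-- The zero function has no weak gradient but zero: each coordinate of the gradient is orthogonal
to all test functions, so it vanishes by the fundamental lemma of the calculus of variations. -/
theorem HasWeakGradient.eq_zero_of_fn_eq_zero {g : L2Vec Ω} (h : HasWeakGradient Ω 0 g) :
    g = 0 := by
  have hcoord : ∀ i : Fin d,
      ∀ᵐ x ∂(volume : Measure (EuclideanSpace ℝ (Fin d))).restrict (Ω : Set _), g x i = 0 := by
    intro i
    rw [ae_restrict_iff' Ω.isOpen.measurableSet]
    refine Ω.isOpen.ae_eq_zero_of_integral_contDiff_smul_eq_zero ?_ ?_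
    · exact locallyIntegrableOn_of_locallyIntegrable_restrict
        ((memLp_coord g i).locallyIntegrable (by norm_num))
    · intro ψ hψ hc hsupp
      have e := h ⟨ψ, hψ, hc, hsupp⟩ i
      have e0 : ∫ x in (Ω : Set _), (0 : L2 Ω) x * fderiv ℝ ψ x (EuclideanSpace.single i 1)
          = 0 := by
        refine integral_eq_zero_of_ae ?_
        filter_upwards [Lp.coeFn_zero ℝ 2
          ((volume : Measure (EuclideanSpace ℝ (Fin d))).restrict (Ω : Set _))] with x hx
        exact (congrArg (· * _) hx).trans (zero_mul _)
      have e1 : ∫ x in (Ω : Set _), g x i * ψ x = 0 := by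
        rw [← neg_eq_zero]
        exact e.symm.trans e0
      rw [← setIntegral_eq_integral_of_forall_compl_eq_zero (s := (Ω : Set _)), ← e1]
      · simp only [smul_eq_mul, mul_comm]
      -- The test function vanishes off `Ω`, so integrating over `Ω` or over the whole space agree.
      · intro x hx
        rw [image_eq_zero_of_notMem_tsupport fun hx' => hx (hsupp hx'), zero_smul]
  rw [Lp.eq_zero_iff_ae_eq_zero]
  filter_upwards [ae_all_iff.2 hcoord] with x hx
  ext i
  exact hx i

/-- The embedding of `H¹₀(Ω)` into `L²(Ω)` is injective: the weak gradient is unique. -/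
theorem H01.eq_zero_of_fn_eq_zero {v : H01 Ω} (hv : H01.fn v = 0) : v = 0 := by
  have hw : HasWeakGradient Ω (H01.fn v) (H01.grad v) := (v : H1 Ω).2
  rw [hv] at hw
  have hg := hw.eq_zero_of_fn_eq_zero
  rw [← inner_self_eq_zero (𝕜 := ℝ), H01.inner_eq, hv, hg, inner_zero_left, inner_zero_left,
    add_zero]

end Sobolev

/-! ### The eigenfunctions as a Hilbert basis of `H¹₀(Ω)` -/

section Spectral

variable {d : ℕ} {Ω : Opens (EuclideanSpace ℝ (Fin d))} {lam : ℕ → ℝ} {φ : ℕ → H01 Ω}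

/-- The rescaled eigenfunction `(1 + lam k) ^ (-1/2) φ k`, of norm one in `H¹`. -/
noncomputable def sobolevMode (lam : ℕ → ℝ) (φ : ℕ → H01 Ω) (k : ℕ) : H01 Ω :=
  (1 + lam k) ^ (-(1 / 2) : ℝ) • φ k

namespace IsDirichletSpectralDecomposition

theorem lam_nonneg (h : IsDirichletSpectralDecomposition Ω lam φ) (k : ℕ) : 0 ≤ lam k := by
  have e := h.eigen k (φ k)
  have h1 : ‖H01.fn (φ k)‖ = 1 := h.orthonormal.1 k
  rw [real_inner_self_eq_norm_sq (H01.fn (φ k)), h1, one_pow, mul_one] at e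
  rw [← e]
  exact real_inner_self_nonneg

theorem one_add_lam_pos (h : IsDirichletSpectralDecomposition Ω lam φ) (k : ℕ) :
    0 < 1 + lam k := by
  linarith [h.lam_nonneg k]

/-- The eigenvalue equation turns `H¹` inner products with an eigenfunction into `L²` ones. -/
theorem inner_eigenfunction (h : IsDirichletSpectralDecomposition Ω lam φ) (k : ℕ) (v : H01 Ω) :
    inner ℝ (φ k) v = (1 + lam k) * inner ℝ (H01.fn (φ k)) (H01.fn v) := by
  rw [H01.inner_eq, h.eigen, add_mul, one_mul]

theorem eq_zero_of_inner_eigenfunction_eq_zero (h : IsDirichletSpectralDecomposition Ω lam φ)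
    {v : H01 Ω} (hv : ∀ k, inner ℝ (φ k) v = 0) : v = 0 := by
  refine H01.eq_zero_of_fn_eq_zero ?_
  have hd : Dense (Submodule.span ℝ (Set.range fun k => H01.fn (φ k)) : Set (L2 Ω)) :=
    Submodule.dense_iff_topologicalClosure_eq_top.2 h.total
  refine hd.eq_zero_of_inner_right (𝕜 := ℝ) fun y hy => ?_
  induction hy using Submodule.span_induction with
  | mem y hy =>
    obtain ⟨k, rfl⟩ := hy
    have e := hv k
    rw [h.inner_eigenfunction] at e
    exact (mul_eq_zero.1 e).resolve_left (h.one_add_lam_pos k).ne'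
  | zero => exact inner_zero_left _
  | add y z _ _ ey ez => rw [inner_add_left, ey, ez, add_zero]
  | smul c y _ ey => rw [real_inner_smul_left, ey, mul_zero]

theorem orthonormal_sobolevMode (h : IsDirichletSpectralDecomposition Ω lam φ) :
    Orthonormal ℝ (sobolevMode lam φ) := by
  rw [orthonormal_iff_ite]
  intro i j
  have ho := orthonormal_iff_ite.1 h.orthonormal i j
  rw [sobolevMode, sobolevMode, real_inner_smul_left, real_inner_smul_right,
    h.inner_eigenfunction, ho]
  split_ifs with hij
  · subst hij
    have hp := h.one_add_lam_pos i
    have hr : (1 + lam i) ^ (-(1 / 2) : ℝ) * (1 + lam i) ^ (-(1 / 2) : ℝ) = (1 + lam i)⁻¹ := by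
      rw [← Real.rpow_add hp, ← Real.rpow_neg_one]
      norm_num
    rw [mul_one, ← mul_assoc, hr, inv_mul_cancel₀ hp.ne']
  · simp

theorem exists_hilbertBasis_eq_sobolevMode (h : IsDirichletSpectralDecomposition Ω lam φ) :
    ∃ b : HilbertBasis ℕ ℝ (H01 Ω), ⇑b = sobolevMode lam φ := by
  have hbot : (Submodule.span ℝ (Set.range (sobolevMode lam φ)))ᗮ = ⊥ := by
    rw [Submodule.eq_bot_iff]
    intro v hv
    refine h.eq_zero_of_inner_eigenfunction_eq_zero fun k => ?_
    have e := hv (sobolevMode lam φ k) (Submodule.subset_span (Set.mem_range_self k))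
    rw [sobolevMode, real_inner_smul_left] at e
    exact (mul_eq_zero.1 e).resolve_left (Real.rpow_pos_of_pos (h.one_add_lam_pos k) _).ne'
  exact ⟨HilbertBasis.mkOfOrthogonalEqBot h.orthonormal_sobolevMode hbot,
    HilbertBasis.coe_mkOfOrthogonalEqBot _ _⟩

/-- Parseval's identity for the Riesz representative of a functional on `H¹₀(Ω)`. -/
theorem hasSum_sq_sobolevMode (h : IsDirichletSpectralDecomposition Ω lam φ) (R : Hneg1 Ω) :
    HasSum (fun k => R (sobolevMode lam φ k) ^ 2) (‖R‖ ^ 2) := by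
  obtain ⟨b, hb⟩ := h.exists_hilbertBasis_eq_sobolevMode
  set r : H01 Ω := (InnerProductSpace.toDual ℝ (H01 Ω)).symm R
  have hr : ∀ v, inner ℝ r v = R v := fun v => InnerProductSpace.toDual_symm_apply
  have hn : ‖r‖ = ‖R‖ := LinearIsometryEquiv.norm_map _ R
  have hs := b.hasSum_inner_mul_inner r r
  rw [real_inner_self_eq_norm_sq, hn] at hs
  refine hs.congr_fun fun k => ?_
  rw [real_inner_comm r (b k), hr, hb, sq]

end IsDirichletSpectralDecomposition

end Spectral

/-! ### Second moments of random evaluations -/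

section Probability

variable {Ξ : Type*} [MeasurableSpace Ξ] {μ : Measure Ξ} [IsProbabilityMeasure μ]

/-- A variance equal to one forces square integrability, as the variance of a variable outside
`L²` is zero by convention. -/
theorem memLp_two_of_variance_eq_one {X : Ξ → ℝ} (hX : AEMeasurable X μ)
    (hvar : variance X μ = 1) : MemLp X 2 μ := by
  by_contra hn
  rw [variance_of_not_memLp hX.aestronglyMeasurable hn] at hvar
  exact zero_ne_one hvar

/-- Independent variables of mean zero and variance one are orthonormal in `L²(μ)`; stated through
the variance of the sum, which equals its second moment as its mean is zero. -/
theorem integral_sq_sum_mul {ι : Type*} {w : ι → Ξ → ℝ} (hmem : ∀ k, MemLp (w k) 2 μ)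
    (hindep : iIndepFun w μ) (hmean : ∀ k, ∫ ξ, w k ξ ∂μ = 0)
    (hvar : ∀ k, variance (w k) μ = 1) (c : ι → ℝ) (s : Finset ι) :
    ∫ ξ, (∑ k ∈ s, c k * w k ξ) ^ 2 ∂μ = ∑ k ∈ s, c k ^ 2 := by
  have hm : ∀ k, MemLp (fun ξ => c k * w k ξ) 2 μ := fun k => (hmem k).const_mul _
  have hvs := IndepFun.variance_sum (s := s) (X := fun k ξ => c k * w k ξ) (fun k _ => hm k)
    fun i _ j _ hij => (hindep.indepFun hij).comp (measurable_const_mul (c i))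
      (measurable_const_mul (c j))
  have hint : ∫ ξ, (∑ k ∈ s, fun ξ => c k * w k ξ) ξ ∂μ = 0 := by
    simp only [Finset.sum_apply]
    rw [integral_finsetSum _ fun k _ => (hm k).integrable one_le_two]
    exact Finset.sum_eq_zero fun k _ => by rw [integral_const_mul, hmean, mul_zero]
  rw [variance_of_integral_eq_zero (memLp_finsetSum' s fun k _ => hm k).aemeasurable hint] at hvs
  simp only [Finset.sum_apply, variance_const_mul, hvar, mul_one] at hvs
  exact hvs

end Probability

/-! ### The `Φ`-norm as a multiple of the dual norm -/

section PhiNorm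

theorem norm_dual_eq_zero_iff {E : Type*} [NormedAddCommGroup E] [NormedSpace ℝ E]
    (R : E →L[ℝ] ℝ) : ‖R‖ = 0 ↔ ∀ v, R v = 0 :=
  norm_eq_zero.trans ContinuousLinearMap.ext_iff

variable {d : ℕ} {Ω : Opens (EuclideanSpace ℝ (Fin d))} {Ξ : Type*} {lam : ℕ → ℝ} {φ : ℕ → H01 Ω}
  {w : ℕ → Ξ → ℝ}

theorem apply_randomTest (R : Hneg1 Ω) (τ : ℝ) (n : ℕ) (ξ : Ξ) :
    R (randomTest τ lam φ w n ξ)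
      = τ * ∑ k ∈ Finset.range n, R (sobolevMode lam φ k) * w k ξ := by
  simp only [randomTest, sobolevMode, map_smul, map_sum, smul_eq_mul]
  congr 1
  exact Finset.sum_congr rfl fun k _ => by ring

variable [MeasurableSpace Ξ] {μ : Measure Ξ}

theorem integrable_sq_randomTest (hmem : ∀ k, MemLp (w k) 2 μ) (R : Hneg1 Ω) (τ : ℝ) (n : ℕ) :
    Integrable (fun ξ => |R (randomTest τ lam φ w n ξ)| ^ 2) μ := by
  simp only [sq_abs, apply_randomTest]
  exact ((memLp_finsetSum _ fun k _ => (hmem k).const_mul _).const_mul τ).integrable_sq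

variable [IsProbabilityMeasure μ]

theorem integral_sq_randomTest (hmem : ∀ k, MemLp (w k) 2 μ) (hindep : iIndepFun w μ)
    (hmean : ∀ k, ∫ ξ, w k ξ ∂μ = 0) (hvar : ∀ k, variance (w k) μ = 1) (R : Hneg1 Ω) (τ : ℝ)
    (n : ℕ) :
    ∫ ξ, |R (randomTest τ lam φ w n ξ)| ^ 2 ∂μ
      = τ ^ 2 * ∑ k ∈ Finset.range n, R (sobolevMode lam φ k) ^ 2 := by
  simp only [sq_abs, apply_randomTest, mul_pow]
  rw [integral_const_mul, integral_sq_sum_mul hmem hindep hmean hvar]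

theorem tendsto_integral_sq_randomTest (hφ : IsDirichletSpectralDecomposition Ω lam φ)
    (hmem : ∀ k, MemLp (w k) 2 μ) (hindep : iIndepFun w μ)
    (hmean : ∀ k, ∫ ξ, w k ξ ∂μ = 0) (hvar : ∀ k, variance (w k) μ = 1) (R : Hneg1 Ω) (τ : ℝ) :
    Tendsto (fun n : ℕ => ∫ ξ, |R (randomTest τ lam φ w n ξ)| ^ 2 ∂μ) atTop
      (𝓝 (τ ^ 2 * ‖R‖ ^ 2)) := by
  simp only [integral_sq_randomTest hmem hindep hmean hvar]
  exact (hφ.hasSum_sq_sobolevMode R).tendsto_sum_nat.const_mul _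

theorem phiNorm_eq (hφ : IsDirichletSpectralDecomposition Ω lam φ)
    (hmem : ∀ k, MemLp (w k) 2 μ) (hindep : iIndepFun w μ)
    (hmean : ∀ k, ∫ ξ, w k ξ ∂μ = 0) (hvar : ∀ k, variance (w k) μ = 1) (R : Hneg1 Ω)
    {τ : ℝ} (hτ : 0 ≤ τ) :
    phiNorm μ τ lam φ w R = τ * ‖R‖ := by
  rw [phiNorm, phiNormSq,
    (tendsto_integral_sq_randomTest hφ hmem hindep hmean hvar R τ).limUnder_eq, ← mul_pow,
    Real.sqrt_sq (mul_nonneg hτ (norm_nonneg R))]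

end PhiNorm

end StochWeak

theorem mainTheorem2 {d : ℕ} (Ω : TopologicalSpace.Opens (EuclideanSpace ℝ (Fin d)))
    (hΩ : Bornology.IsBounded (Ω : Set (EuclideanSpace ℝ (Fin d))))
    (lam : ℕ → ℝ) (φ : ℕ → StochWeak.H01 Ω)
    (hφ : StochWeak.IsDirichletSpectralDecomposition Ω lam φ)
    (τ : ℝ) (hτ : 0 < τ)
    {Ξ : Type*} [MeasurableSpace Ξ] (μ : MeasureTheory.Measure Ξ)
    [MeasureTheory.IsProbabilityMeasure μ]
    (w : ℕ → Ξ → ℝ) (hw_meas : ∀ k, AEMeasurable (w k) μ)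
    (hw_indep : ProbabilityTheory.iIndepFun w μ)
    (hw_mean : ∀ k, ∫ ξ, w k ξ ∂μ = 0)
    (hw_var : ∀ k, ProbabilityTheory.variance (w k) μ = 1)
    (L : StochWeak.H01 Ω →ₗ[ℝ] StochWeak.Hneg1 Ω) (f : StochWeak.Hneg1 Ω) :
    -- the norm of the residual is well defined: all expectations are finite, the limit exists
    (∀ u : StochWeak.H01 Ω,
      (∀ n : ℕ, MeasureTheory.Integrable
        (fun ξ => |StochWeak.residual L f u (StochWeak.randomTest τ lam φ w n ξ)| ^ 2) μ) ∧
      Filter.Tendsto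
        (fun n : ℕ => ∫ ξ, |StochWeak.residual L f u (StochWeak.randomTest τ lam φ w n ξ)| ^ 2 ∂μ)
        Filter.atTop
        (nhds (StochWeak.phiNorm μ τ lam φ w (StochWeak.residual L f u) ^ 2))) ∧
    -- the two notions of solution coincide
    (∀ u : StochWeak.H01 Ω,
      StochWeak.IsWeakSolution L f u ↔
        StochWeak.IsStochasticallyWeakSolution μ τ lam φ w L f u) ∧
    -- at most one solution, and exactly one solution, in either sense
    ({u | StochWeak.IsWeakSolution L f u}.Subsingleton ↔
      {u | StochWeak.IsStochasticallyWeakSolution μ τ lam φ w L f u}.Subsingleton) ∧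
    ((∃! u, StochWeak.IsWeakSolution L f u) ↔
      ∃! u, StochWeak.IsStochasticallyWeakSolution μ τ lam φ w L f u) := by
  have hmem : ∀ k, MemLp (w k) 2 μ := fun k =>
    StochWeak.memLp_two_of_variance_eq_one (hw_meas k) (hw_var k)
  have hnorm : ∀ R : StochWeak.Hneg1 Ω, StochWeak.phiNorm μ τ lam φ w R = τ * ‖R‖ := fun R =>
    StochWeak.phiNorm_eq hφ hmem hw_indep hw_mean hw_var R hτ.le
  have hiff : ∀ u : StochWeak.H01 Ω, StochWeak.IsWeakSolution L f u ↔
      StochWeak.IsStochasticallyWeakSolution μ τ lam φ w L f u := by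
    intro u
    rw [StochWeak.IsStochasticallyWeakSolution, hnorm, mul_eq_zero, or_iff_right hτ.ne']
    exact (StochWeak.norm_dual_eq_zero_iff (E := StochWeak.H01 Ω) _).symm
  refine ⟨fun u => ⟨fun n => StochWeak.integrable_sq_randomTest hmem _ τ n, ?_⟩, hiff, ?_, ?_⟩
  · rw [hnorm, mul_pow]
    exact StochWeak.tendsto_integral_sq_randomTest hφ hmem hw_indep hw_mean hw_var _ τ
  · simp only [hiff]
  · simp only [hiff]
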